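/- Let $\Gamma$ be a finite graph, i.e. (the underlying space of) a finite simplicial complex of dimension at most one. Assume that $\Gamma$ is connected and not homeomorphic to the circle $S^1$. Let $F(\Gamma,2)=\{(x,y)\in\Gamma\times\Gamma : x\neq y\}$ with the subspace topology, and let $\alpha\colon F(\Gamma,2)\to\Gamma\times\Gamma$ be the inclusion. Then, for singular homology and cohomology with integral coefficients, $\alpha$ induces an epimorphism $$\alpha_*\colon H_1(F(\Gamma,2))\to H_1(\Gamma\times\Gamma)$$ and a monomorphism $$\alpha^*\colon H^1(\Gamma\times\Gamma)\to H^1(F(\Gamma,2)).$$ -/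

import Mathlib

open CategoryTheory

universe u

/-- A finite graph, as a geometric simplicial complex: finitely many simplices, all of them of
dimension at most one (vertices and straight edges). The topological space of the graph is
`K.space`. -/
structure IsFiniteGraph {E : Type u} [AddCommGroup E] [Module ℝ E]
    (K : Geometry.SimplicialComplex ℝ E) : Prop where
  finite_faces : K.faces.Finite
  card_le_two : ∀ s ∈ K.faces, s.card ≤ 2

/-- The configuration space `F(X, 2) = X × X - Δ` of ordered pairs of distinct points of `X`,
with the subspace topology. -/
abbrev ConfigSpaceTwo (X : Type u) : Type u := {p : X × X // p.1 ≠ p.2}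

/-- The inclusion `F(X, 2) → X × X`. -/
def configInclusion (X : Type u) [TopologicalSpace X] :
    TopCat.of (ConfigSpaceTwo X) ⟶ TopCat.of (X × X) :=
  TopCat.ofHom ⟨Subtype.val, continuous_subtype_val⟩

/-- The additive group of integers, as an object of the category of abelian groups in the
universe `u`. -/
abbrev integerCoeff : AddCommGrpCat.{u} := AddCommGrpCat.of (ULift.{u} ℤ)

/-- The singular chain complex with integral coefficients. -/
noncomputable abbrev singularChains : TopCat.{u} ⥤ ChainComplex AddCommGrpCat.{u} ℕ :=
  (AlgebraicTopology.singularChainComplexFunctor AddCommGrpCat.{u}).obj integerCoeff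

/-- Singular homology `H_n` with integral coefficients. -/
noncomputable abbrev singularHomologyInt (n : ℕ) : TopCat.{u} ⥤ AddCommGrpCat.{u} :=
  (AlgebraicTopology.singularHomologyFunctor AddCommGrpCat.{u} n).obj integerCoeff

/-- Singular cohomology `H^n` with integral coefficients: the cohomology of the cochain complex
`Hom(C_•(X), ℤ)`. -/
noncomputable def singularCohomologyInt (n : ℕ) : TopCat.{u}ᵒᵖ ⥤ AddCommGrpCat.{u} :=
  singularChains.op ⋙ HomologicalComplex.opFunctor AddCommGrpCat.{u} (ComplexShape.down ℕ) ⋙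
    (preadditiveYoneda.obj integerCoeff).mapHomologicalComplex (ComplexShape.down ℕ).symm ⋙
      HomologicalComplex.homologyFunctor AddCommGrpCat.{u} (ComplexShape.down ℕ).symm n

/-! Both halves follow from one statement about $X=|\Gamma|$: a homotopy invariant, additive
function of paths in $X\times X$ that vanishes on loops off the diagonal vanishes on all loops
(`DetectsLoops`). A singular 1-cocycle is such a function of paths, and it is a coboundary once it
vanishes on loops. Coefficients in the chains modulo boundaries, divided by the image of $H_1(F)$,
give surjectivity on $H_1$; integral coefficients give injectivity on $H^1$.

In a product, a loop is homotopic to a loop in the first factor followed by one in the second, and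
the value of a loop $p\times y$ does not depend on $y$. If $p$ misses a point $z$, take $y=z$: the
loop $p\times z$ avoids the diagonal. So it suffices that a function of paths in $X$ vanishing on
loops that miss a point vanishes on all loops (`loop_eq_zero_of_offDiag`).

On a graph such a function is governed by its values on edges, and it has a potential if its sums
along simple cycles vanish (`SimpleGraph.exists_potential`, `loop_eq_zero_of_potential`). A simple
cycle covering the whole graph would make it a circle, so every simple cycle misses a point
(`loop_eq_zero_of_missing_point`). -/

open scoped unitInterval

/-! ### Additive homotopy invariants of paths -/

/-- A homotopy invariant of paths in `X` with values in an abelian group which is additive under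
concatenation, i.e. a functor from the fundamental groupoid of `X` to the group `A`. -/
structure PathCocycle (X : Type*) [TopologicalSpace X] (A : Type*) [AddCommGroup A] where
  /-- The value of the cocycle on a path. -/
  toFun : ∀ {x y : X}, Path x y → A
  map_trans : ∀ {x y z : X} (p : Path x y) (q : Path y z), toFun (p.trans q) = toFun p + toFun q
  map_homotopic : ∀ {x y : X} {p q : Path x y}, p.Homotopic q → toFun p = toFun q

namespace PathCocycle

variable {X Y A : Type*} [TopologicalSpace X] [TopologicalSpace Y] [AddCommGroup A]

instance : CoeFun (PathCocycle X A) (fun _ => ∀ {x y : X}, Path x y → A) := ⟨PathCocycle.toFun⟩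

variable (Φ : PathCocycle X A)

@[simp]
lemma map_refl (x : X) : Φ (Path.refl x) = 0 := by
  have h := Φ.map_trans (Path.refl x) (Path.refl x)
  rw [Path.refl_trans_refl] at h
  simpa using h

@[simp]
lemma map_symm {x y : X} (p : Path x y) : Φ p.symm = -Φ p := by
  have h := Φ.map_trans p p.symm
  rw [← Φ.map_homotopic (⟨Path.Homotopy.reflTransSymm p⟩ : Path.Homotopic _ _)] at h
  rw [eq_neg_iff_add_eq_zero, add_comm, ← h, map_refl]

@[simp]
lemma map_cast {x y x' y' : X} (p : Path x y) (hx : x' = x) (hy : y' = y) :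
    Φ (p.cast hx hy) = Φ p := by
  subst hx hy; rfl

/-- The cocycle on `Y` obtained from one on `X` by mapping paths along `f : Y → X`. -/
def comap (f : Y → X) (hf : Continuous f) : PathCocycle Y A where
  toFun p := Φ (p.map hf)
  map_trans p q := by rw [Path.map_trans, Φ.map_trans]
  map_homotopic h := Φ.map_homotopic (h.map ⟨f, hf⟩)

/-- Paths with the same endpoints and with values in a common simply connected subspace have the
same value. -/
lemma eq_of_mem_of_simplyConnected {S T : Set X} (hST : S ⊆ T) [SimplyConnectedSpace S]
    (Φ : PathCocycle T A) {x y : T} (p q : Path x y) (hp : ∀ t, (p t : X) ∈ S)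
    (hq : ∀ t, (q t : X) ∈ S) : Φ p = Φ q := by
  have lift : ∀ r : Path x y, (∀ t, (r t : X) ∈ S) → ∃ r' : Path (⟨x, by simpa using hp 0⟩ : S)
      ⟨y, by simpa using hp 1⟩, r = r'.map (continuous_inclusion hST) := by
    intro r hr
    refine ⟨⟨⟨fun t => ⟨r t, hr t⟩, by fun_prop⟩, by ext; simp, by ext; simp⟩, ?_⟩
    ext t; rfl
  obtain ⟨p', hp'⟩ := lift p hp
  obtain ⟨q', hq'⟩ := lift q hq
  rw [hp', hq']
  exact Φ.map_homotopic
    ((SimplyConnectedSpace.paths_homotopic p' q').map ⟨_, continuous_inclusion hST⟩)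

/-- A function which is a potential for the cocycle locally is a potential globally. -/
lemma eq_sub_of_local (f : X → A)
    (h : ∀ x, ∃ U ∈ nhds x, ∀ (y z : X) (p : Path y z), (∀ t, p t ∈ U) → Φ p = f z - f y)
    {x y : X} (p : Path x y) : Φ p = f y - f x := by
  choose U hU hUp using h
  obtain ⟨t, ht0, htm, ⟨n, hn⟩, htU⟩ := exists_monotone_Icc_subset_open_cover_unitInterval
    (c := fun x : X => p ⁻¹' interior (U x)) (fun x => isOpen_interior.preimage p.continuous)
    (fun s _ => Set.mem_iUnion.2 ⟨p s, mem_interior_iff_mem_nhds.2 (hU _)⟩)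
  have key : ∀ k, Φ (p.subpath 0 (t k)) = f (p (t k)) - f (p 0) := by
    intro k
    induction k with
    | zero => rw [ht0, Path.subpath_self]; simp
    | succ k ih =>
      obtain ⟨x, hx⟩ := htU k
      rw [← Φ.map_homotopic ⟨Path.Homotopy.subpathTransSubpath p 0 (t k) (t (k + 1))⟩, Φ.map_trans,
        ih, hUp x _ _ (p.subpath (t k) (t (k + 1)))]
      · abel
      · intro s
        refine interior_subset (hx (?_ : _ ∈ Set.Icc (t k) (t (k + 1))))
        have := Path.range_subpath_of_le p _ _ (htm (Nat.le_succ k))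
        have h2 : Set.Icc.convexComb (t k) (t (k + 1)) s ∈ Set.uIcc (t k) (t (k + 1)) := by
          rw [← Path.range_subpathAux]; exact ⟨s, rfl⟩
        rwa [Set.uIcc_of_le (htm (Nat.le_succ k))] at h2
  have h1 := key n
  rw [hn n le_rfl, Path.subpath_zero_one] at h1
  simpa using h1

/-- Integrate along a chosen path from a base point; vanishing on loops makes the choice irrelevant.
-/
lemma exists_potential [PathConnectedSpace X] (h : ∀ (x : X) (p : Path x x), Φ p = 0) :
    ∃ f : X → A, ∀ (x y : X) (p : Path x y), Φ p = f y - f x := by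
  obtain ⟨b⟩ := (inferInstance : Nonempty X)
  refine ⟨fun x => Φ (PathConnectedSpace.somePath b x), fun x y p => ?_⟩
  have := h b (((PathConnectedSpace.somePath b x).trans p).trans
    (PathConnectedSpace.somePath b y).symm)
  rw [Φ.map_trans, Φ.map_trans, Φ.map_symm] at this
  rw [eq_sub_iff_add_eq', ← sub_eq_zero, ← this]; abel

/-- The diagonal path of a square is homotopic to either pair of sides; this lemma and `map_prod'`
are the two choices. -/
lemma map_prod (Φ : PathCocycle (X × Y) A) {x x' : X} {y y' : Y} (p : Path x x') (q : Path y y') :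
    Φ (p.prod q) = Φ (p.prod (Path.refl y)) + Φ ((Path.refl x').prod q) := by
  rw [← Φ.map_trans, Path.trans_prod_eq_prod_trans]
  exact Φ.map_homotopic
    ⟨Path.Homotopic.prodHomotopy (Path.Homotopy.transRefl p).symm
      (Path.Homotopy.reflTrans q).symm⟩

lemma map_prod' (Φ : PathCocycle (X × Y) A) {x x' : X} {y y' : Y} (p : Path x x') (q : Path y y') :
    Φ (p.prod q) = Φ ((Path.refl x).prod q) + Φ (p.prod (Path.refl y')) := by
  rw [← Φ.map_trans, Path.trans_prod_eq_prod_trans]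
  exact Φ.map_homotopic
    ⟨Path.Homotopic.prodHomotopy (Path.Homotopy.reflTrans p).symm
      (Path.Homotopy.transRefl q).symm⟩

/-- If the cocycles on `X` that vanish on loops missing a point vanish on all loops, then the
cocycles on `X × X` that vanish on loops missing the diagonal vanish on all loops. -/
lemma loop_eq_zero_of_offDiag [PathConnectedSpace X]
    (hX : ∀ Ψ : PathCocycle X A,
      (∀ (z x : X) (p : Path x x), (∀ t, p t ≠ z) → Ψ p = 0) → ∀ (x : X) (p : Path x x), Ψ p = 0)
    (Φ : PathCocycle (X × X) A)
    (hΦ : ∀ (a : X × X) (p : Path a a), (∀ t, (p t).1 ≠ (p t).2) → Φ p = 0)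
    (a : X × X) (p : Path a a) : Φ p = 0 := by
  -- As `p` is a loop, the two ways around the square share the side over `x`, which cancels.
  have h1 : ∀ (x : X) (p : Path x x) (y z : X),
      Φ (p.prod (Path.refl y)) = Φ (p.prod (Path.refl z)) := by
    intro x p y z
    have := (map_prod Φ p (PathConnectedSpace.somePath y z)).symm.trans (map_prod' Φ p _)
    rwa [add_comm, add_left_cancel_iff] at this
  have h2 : ∀ (x : X) (p : Path x x) (y z : X),
      Φ ((Path.refl y).prod p) = Φ ((Path.refl z).prod p) := by
    intro x p y z
    have := (map_prod Φ (PathConnectedSpace.somePath y z) p).symm.trans (map_prod' Φ _ p)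
    rw [add_comm, add_right_cancel_iff] at this
    exact this.symm
  obtain ⟨x, y⟩ := a
  obtain ⟨q, r, rfl⟩ : ∃ (q : Path x x) (r : Path y y), p = q.prod r :=
    ⟨p.map continuous_fst, p.map continuous_snd, by ext <;> rfl⟩
  have k1 := hX (Φ.comap (fun w => (w, y)) (by fun_prop)) (fun z x p hz => by
    have : Φ (p.prod (Path.refl y)) = 0 :=
      (h1 x p y z).trans (hΦ _ _ fun t => by simpa using hz t)
    exact this) x q
  have k2 := hX (Φ.comap (fun w => (x, w)) (by fun_prop)) (fun z y p hz => by
    have : Φ ((Path.refl x).prod p) = 0 :=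
      (h2 y p x z).trans (hΦ _ _ fun t => by simpa using (hz t).symm)
    exact this) y r
  rw [map_prod]
  exact (congrArg₂ (· + ·) k1 k2).trans (add_zero 0)

end PathCocycle

/-! ### Sums along walks in a graph -/

namespace SimpleGraph.Walk

variable {V A : Type*} [AddCommGroup A] {G : SimpleGraph V} (ψ : V → V → A)

/-- The sum of a function of darts along a walk. -/
def dartSum {u v : V} (p : G.Walk u v) : A := (p.darts.map fun d => ψ d.fst d.snd).sum

@[simp] lemma dartSum_nil (u : V) : (nil : G.Walk u u).dartSum ψ = 0 := rfl

@[simp] lemma dartSum_cons {u v w : V} (h : G.Adj u v) (p : G.Walk v w) :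
    (cons h p).dartSum ψ = ψ u v + p.dartSum ψ := by simp [dartSum]

@[simp] lemma dartSum_append {u v w : V} (p : G.Walk u v) (q : G.Walk v w) :
    (p.append q).dartSum ψ = p.dartSum ψ + q.dartSum ψ := by simp [dartSum]

variable {ψ}

lemma dartSum_reverse (hanti : ∀ u v, G.Adj u v → ψ v u = -ψ u v) {u v : V} (p : G.Walk u v) :
    p.reverse.dartSum ψ = -p.dartSum ψ := by
  induction p with
  | nil => simp
  | cons h p ih => simp [ih, hanti _ _ h, add_comm]

/-- Each piece cut out by `bypass` is an edge followed by a path back to its start: either a cycle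
or an edge traversed back and forth, and both have sum zero. -/
lemma dartSum_bypass [DecidableEq V] (hanti : ∀ u v, G.Adj u v → ψ v u = -ψ u v)
    (hcyc : ∀ (u : V) (c : G.Walk u u), c.IsCycle → c.dartSum ψ = 0) {u v : V} (p : G.Walk u v) :
    p.bypass.dartSum ψ = p.dartSum ψ := by
  induction p with
  | nil => rfl
  | @cons u w v h p ih =>
    rw [dartSum_cons, ← ih, bypass]
    split_ifs with hs
    · have hq : (p.bypass.takeUntil u hs).IsPath := p.bypass_isPath.takeUntil hs
      conv_rhs => rw [← p.bypass.take_spec hs, dartSum_append, ← add_assoc]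
      rw [right_eq_add]
      by_cases he : s(u, w) ∈ (p.bypass.takeUntil u hs).edges
      · have : p.bypass.takeUntil u hs = cons h.symm nil := by
          generalize p.bypass.takeUntil u hs = q at *
          cases q with
          | nil => simp at he
          | @cons _ x _ h' q =>
            rw [cons_isPath_iff] at hq
            rw [edges_cons, List.mem_cons] at he
            rcases he with he | he
            · have : x = u := by
                rw [Sym2.eq_iff] at he
                rcases he with ⟨rfl, -⟩ | ⟨rfl, -⟩
                · exact absurd h (SimpleGraph.irrefl _)
                · rfl
              subst this
              rw [(isPath_iff_nil.1 hq.1).eq_nil]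
            · exact absurd (q.snd_mem_support_of_mem_edges he) hq.2
        rw [this]
        simp [hanti _ _ h]
      · exact hcyc u (cons h _) (cons_isCycle_iff _ h |>.2 ⟨hq, he⟩)
    · rw [dartSum_cons]

lemma dartSum_eq_zero_of_isCycle (hanti : ∀ u v, G.Adj u v → ψ v u = -ψ u v)
    (hcyc : ∀ (u : V) (c : G.Walk u u), c.IsCycle → c.dartSum ψ = 0) {u : V} (p : G.Walk u u) :
    p.dartSum ψ = 0 := by
  classical
  rw [← dartSum_bypass hanti hcyc, (isPath_iff_nil.1 p.bypass_isPath).eq_nil, dartSum_nil]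

end SimpleGraph.Walk

/-- An antisymmetric function on the darts of a graph whose sums along all cycles vanish is a
coboundary. -/
lemma SimpleGraph.exists_potential {V A : Type*} [AddCommGroup A] {G : SimpleGraph V}
    {ψ : V → V → A} (hanti : ∀ u v, G.Adj u v → ψ v u = -ψ u v)
    (hcyc : ∀ (u : V) (c : G.Walk u u), c.IsCycle → c.dartSum ψ = 0) :
    ∃ f : V → A, ∀ u v, G.Adj u v → ψ u v = f v - f u := by
  have hr : ∀ v, G.Reachable (G.connectedComponentMk v).out v := fun v =>
    ConnectedComponent.exact (Quot.out_eq _)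
  let w : ∀ v, G.Walk (G.connectedComponentMk v).out v := fun v => (hr v).some
  refine ⟨fun v => (w v).dartSum ψ, fun u v h => ?_⟩
  have e : (G.connectedComponentMk u).out = (G.connectedComponentMk v).out := by
    rw [ConnectedComponent.sound h.reachable]
  have := Walk.dartSum_eq_zero_of_isCycle hanti hcyc
    (((w u).append (.cons h (w v).reverse)).copy rfl e.symm)
  have h2 : ∀ {a b a' b' : V} (p : G.Walk a b) (ha : a = a') (hb : b = b'),
    (p.copy ha hb).dartSum ψ = p.dartSum ψ := by rintro _ _ _ _ p rfl rfl; rfl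
  rw [h2, Walk.dartSum_append, Walk.dartSum_cons, Walk.dartSum_reverse hanti] at this
  rw [eq_sub_iff_add_eq', ← sub_eq_zero, ← this]; abel

/-! ### Gluing arcs; recognising the circle -/

lemma Path.trans_apply_eq {X : Type*} [TopologicalSpace X] {a b c : X} (α : Path a b)
    (β : Path b c) (t : I) : (∃ s : I, (t : ℝ) = s / 2 ∧ α.trans β t = α s) ∨
      (∃ s : I, 0 < s ∧ (t : ℝ) = (1 + s) / 2 ∧ α.trans β t = β s) := by
  rw [Path.trans_apply]
  split_ifs with h
  · exact .inl ⟨_, by simp, rfl⟩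
  · push Not at h
    exact .inr ⟨_, by rw [← Subtype.coe_lt_coe]; simp; linarith, by simp, rfl⟩

lemma Path.trans_injective {X : Type*} [TopologicalSpace X] {a b c : X} {α : Path a b}
    {β : Path b c} (hα : Function.Injective α) (hβ : Function.Injective β)
    (h : Set.range α ∩ Set.range β ⊆ {b}) : Function.Injective (α.trans β) := by
  have key : ∀ s t : I, 0 < t → α s ≠ β t := by
    intro s t ht he
    have h1 : β t = b := h ⟨⟨s, he⟩, ⟨t, rfl⟩⟩
    exact ht.ne' (hβ (h1.trans β.source.symm))
  intro s t hst
  apply Subtype.ext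
  rcases α.trans_apply_eq β s with ⟨s', hs, es⟩ | ⟨s', hs0, hs, es⟩ <;>
  rcases α.trans_apply_eq β t with ⟨t', ht, et⟩ | ⟨t', ht0, ht, et⟩ <;>
  rw [es, et] at hst
  · rw [hs, ht, hα hst]
  · exact absurd hst (key _ _ ht0)
  · exact absurd hst.symm (key _ _ hs0)
  · rw [hs, ht, hβ hst]

/-- A Hausdorff space which is the union of two arcs that only meet in their endpoints is
homeomorphic to the circle. -/
theorem nonempty_homeomorph_circle_of_arcs {X : Type*} [TopologicalSpace X] [T2Space X] {a b : X}
    {α : Path a b} {β : Path b a} (hα : Function.Injective α) (hβ : Function.Injective β)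
    (hinter : Set.range α ∩ Set.range β ⊆ {a, b})
    (hunion : Set.range α ∪ Set.range β = Set.univ) : Nonempty (X ≃ₜ Circle) := by
  have : Fact ((0 : ℝ) < 1) := ⟨one_pos⟩
  let γ := α.trans β
  let F : AddCircle (1 : ℝ) → X := AddCircle.liftIco 1 0 γ.extend
  have hF : Continuous F := AddCircle.liftIco_continuous (by simp [γ])
    γ.continuous_extend.continuousOn
  have hval : ∀ t : I, F ((t : ℝ) : AddCircle (1 : ℝ)) = γ t := by
    intro t
    rcases eq_or_lt_of_le t.2.2 with h | h
    · have : t = 1 := Subtype.ext h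
      subst this
      have h0 := AddCircle.liftIco_coe_apply (p := (1 : ℝ)) (a := 0) (f := γ.extend) (x := 0)
        (by simp)
      have h1 : ((1 : ℝ) : AddCircle (1 : ℝ)) = ((0 : ℝ) : AddCircle (1 : ℝ)) := by
        simp [AddCircle.coe_period (1 : ℝ)]
      simp only [F, Set.Icc.coe_one, h1]
      rw [h0]; simp [γ]
    · simp only [F]
      rw [AddCircle.liftIco_coe_apply ⟨t.2.1, by simpa using h⟩]
      exact γ.extend_extends' t
  have hrep : ∀ z : AddCircle (1 : ℝ), ∃ t : I, t < 1 ∧ z = ((t : ℝ) : AddCircle (1 : ℝ)) := by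
    intro z
    have hz : z ∈ (fun x : ℝ => (x : AddCircle (1 : ℝ))) '' Set.Ico 0 (0 + 1) := by
      rw [AddCircle.coe_image_Ico_eq]; trivial
    obtain ⟨t, ht, rfl⟩ := hz
    rw [zero_add] at ht
    exact ⟨⟨t, ht.1, ht.2.le⟩, by rw [← Subtype.coe_lt_coe]; exact ht.2, rfl⟩
  -- The arcs meet only at `a` and `b`, which `β` attains only at its ends; `t < 1` will come from
  -- the half-open fundamental domain.
  have key : ∀ s t : I, 0 < t → t < 1 → α s ≠ β t := by
    intro s t ht ht1 he
    rcases hinter ⟨⟨s, he⟩, ⟨t, rfl⟩⟩ with h1 | h1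
    · exact ht1.ne (hβ (h1.trans β.target.symm))
    · exact ht.ne' (hβ (h1.trans β.source.symm))
  have hlt : ∀ {t t' : I}, t < 1 → (t : ℝ) = (1 + t') / 2 → t' < 1 := by
    intro t t' h e
    rw [← Subtype.coe_lt_coe] at h ⊢
    simp only [Set.Icc.coe_one] at *; linarith
  have hinj : Function.Injective F := by
    intro z w hzw
    obtain ⟨s, hs1, rfl⟩ := hrep z
    obtain ⟨t, ht1, rfl⟩ := hrep w
    rw [hval, hval] at hzw
    congr 1
    rcases α.trans_apply_eq β s with ⟨s', hs, es⟩ | ⟨s', hs0, hs, es⟩ <;>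
    rcases α.trans_apply_eq β t with ⟨t', ht, et⟩ | ⟨t', ht0, ht, et⟩ <;>
    simp only [γ] at hzw <;>
    rw [es, et] at hzw
    · rw [hs, ht, hα hzw]
    · exact absurd hzw (key _ _ ht0 (hlt ht1 ht))
    · exact absurd hzw.symm (key _ _ hs0 (hlt hs1 hs))
    · rw [hs, ht, hβ hzw]
  have hsurj : Function.Surjective F := by
    intro x
    have hx : x ∈ Set.range γ := by
      rw [Path.trans_range, hunion]; trivial
    obtain ⟨t, rfl⟩ := hx
    exact ⟨_, hval t⟩
  exact ⟨((hF.homeoOfEquivCompactToT2 (f := Equiv.ofBijective F ⟨hinj, hsurj⟩)).symm).trans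
    (AddCircle.homeomorphCircle one_ne_zero)⟩

/-! ### Straight paths and values on segments -/

section Segment

variable {E : Type*} [NormedAddCommGroup E] [NormedSpace ℝ E] {T : Set E}

/-- The straight path between two points of a set containing the segment they span. -/
def segmentPath {x y : T} (h : segment ℝ (x : E) y ⊆ T) : Path x y where
  toFun t := ⟨AffineMap.lineMap (x : E) (y : E) (t : ℝ), h <| by
    rw [segment_eq_image_lineMap]; exact ⟨t, t.2, rfl⟩⟩
  continuous_toFun := by
    refine Continuous.subtype_mk ?_ _
    exact AffineMap.lineMap_continuous.comp continuous_subtype_val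
  source' := by ext; simp
  target' := by ext; simp

lemma segmentPath_mem {x y : T} (h : segment ℝ (x : E) y ⊆ T) (t : I) :
    (segmentPath h t : E) ∈ segment ℝ (x : E) y := by
  rw [segment_eq_image_lineMap]; exact ⟨t, t.2, rfl⟩

lemma exists_segmentPath_eq {x y : T} (h : segment ℝ (x : E) y ⊆ T) {z : T}
    (hz : (z : E) ∈ segment ℝ (x : E) y) : ∃ t, segmentPath h t = z := by
  rw [segment_eq_image_lineMap] at hz
  obtain ⟨t, ht, e⟩ := hz
  exact ⟨⟨t, ht⟩, Subtype.ext e⟩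

lemma segmentPath_injective {x y : T} (h : segment ℝ (x : E) y ⊆ T) (hxy : x ≠ y) :
    Function.Injective (segmentPath h) := by
  intro s t hst
  have := AffineMap.lineMap_injective ℝ (fun e => hxy (Subtype.ext e) : (x : E) ≠ y)
    (congrArg Subtype.val hst)
  exact Subtype.ext this

end Segment

namespace PathCocycle

variable {E : Type*} [NormedAddCommGroup E] [NormedSpace ℝ E] {T : Set E} {A : Type*}
  [AddCommGroup A] (Φ : PathCocycle T A)

open Classical in
/-- The value of a cocycle on a straight path. -/
noncomputable def onSegment (x y : T) : A :=
  -- The default 0 makes this a total function of two points, so that it can be summed along walks.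
  if h : segment ℝ (x : E) y ⊆ T then Φ (segmentPath h) else 0

lemma onSegment_eq {x y : T} (h : segment ℝ (x : E) y ⊆ T) :
    Φ.onSegment x y = Φ (segmentPath h) := dif_pos h

/-- Inside a star-shaped set, the value on the segment from the centre is a potential. -/
lemma apply_eq_onSegment_sub {S : Set E} {u : T} (hST : S ⊆ T) (hS : StarConvex ℝ (u : E) S)
    {x y : T} (p : Path x y) (hp : ∀ t, (p t : E) ∈ S) :
    Φ p = Φ.onSegment u y - Φ.onSegment u x := by
  have hx : (x : E) ∈ S := by simpa using hp 0
  have hy : (y : E) ∈ S := by simpa using hp 1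
  have hux : segment ℝ (u : E) x ⊆ S := hS.segment_subset hx
  have huy : segment ℝ (u : E) y ⊆ S := hS.segment_subset hy
  have := hS.contractibleSpace ⟨_, hx⟩
  rw [Φ.onSegment_eq (hux.trans hST), Φ.onSegment_eq (huy.trans hST), eq_sub_iff_add_eq',
    ← Φ.map_trans]
  refine eq_of_mem_of_simplyConnected hST Φ _ _ (fun t => ?_)
    (fun t => huy (segmentPath_mem _ t))
  rcases Path.trans_apply_eq (segmentPath (hux.trans hST)) p t with ⟨s, -, e⟩ | ⟨s, -, -, e⟩ <;>
    rw [e]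
  · exact hux (segmentPath_mem _ s)
  · exact hp s

/-- A convex set is star-shaped about `x`, so the value on segments from `x` is a potential there.
-/
lemma onSegment_add {S : Set E} (hST : S ⊆ T) (hS : Convex ℝ S) {x y z : T} (hx : (x : E) ∈ S)
    (hy : (y : E) ∈ S) (hz : (z : E) ∈ S) :
    Φ.onSegment x y + Φ.onSegment y z = Φ.onSegment x z := by
  have h := hS.segment_subset hy hz
  rw [Φ.onSegment_eq (h.trans hST), Φ.apply_eq_onSegment_sub hST (hS.starConvex hx)
    (segmentPath (h.trans hST)) (fun t => h (segmentPath_mem _ t))]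
  abel

lemma onSegment_symm {x y : T} (h : segment ℝ (x : E) y ⊆ T) :
    Φ.onSegment y x = -Φ.onSegment x y := by
  have h1 := Φ.onSegment_add h (convex_segment _ _) (right_mem_segment _ _ _)
    (left_mem_segment _ _ _) (right_mem_segment _ _ _)
  have h2 := Φ.onSegment_add h (convex_segment _ _) (right_mem_segment ℝ (x : E) _)
    (right_mem_segment _ _ _) (right_mem_segment _ _ _)
  rw [eq_neg_iff_add_eq_zero, h1]
  simpa using h2

end PathCocycle

/-! ### Closed stars and potentials on a simplicial complex -/

namespace Geometry.SimplicialComplex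

variable {E : Type*} [NormedAddCommGroup E] [NormedSpace ℝ E] (K : SimplicialComplex ℝ E)

/-- The closed star of a point: the union of the simplices with `u` as a vertex. -/
def closedStar (u : E) : Set E := {x | ∃ s ∈ K.faces, u ∈ s ∧ x ∈ convexHull ℝ (s : Set E)}

variable {K}

lemma closedStar_subset (u : E) : K.closedStar u ⊆ K.space := fun _ ⟨_, hs, _, hx⟩ =>
  K.convexHull_subset_space hs hx

lemma starConvex_closedStar (u : E) : StarConvex ℝ u (K.closedStar u) := by
  rintro x ⟨s, hs, hu, hx⟩ a b ha hb hab
  exact ⟨s, hs, hu, convex_convexHull ℝ _ (subset_convexHull ℝ _ hu) hx ha hb hab⟩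

lemma mem_vertices_of_mem {s : Finset E} (hs : s ∈ K.faces) {u : E} (hu : u ∈ s) :
    u ∈ K.vertices :=
  K.down_closed hs (by simpa using hu) (by simp)

/-- Take `u` in a smallest simplex containing `x`. The simplices without the vertex `u` form a
closed set missing `x`, and its complement lies in the star of `u`. -/
lemma exists_closedStar_mem_nhds (hK : K.faces.Finite) (x : K.space) :
    ∃ u : K.space, (u : E) ∈ K.vertices ∧ Subtype.val ⁻¹' K.closedStar u ∈ nhds x := by
  classical
  have hne : (hK.toFinset.filter fun s : Finset E =>
      (x : E) ∈ convexHull ℝ (s : Set E)).Nonempty := by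
    obtain ⟨s, hs, hx⟩ := mem_space_iff.1 x.2
    exact ⟨s, by simpa using ⟨hs, hx⟩⟩
  obtain ⟨s, hs, hmin⟩ := Finset.exists_min_image _ Finset.card hne
  simp only [Finset.mem_filter, Set.Finite.mem_toFinset, and_imp] at hs hmin
  obtain ⟨u, hu⟩ := K.nonempty_of_mem_faces hs.1
  refine ⟨⟨u, K.subset_space hs.1 hu⟩, mem_vertices_of_mem hs.1 hu, ?_⟩
  have hcl : IsClosed (⋃ t ∈ {t ∈ K.faces | u ∉ t}, convexHull ℝ (t : Set E)) :=
    (hK.subset (Set.sep_subset _ _)).isClosed_biUnion fun t _ =>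
      (t.finite_toSet.isCompact_convexHull ℝ).isClosed
  have hxn : (x : E) ∉ ⋃ t ∈ {t ∈ K.faces | u ∉ t}, convexHull ℝ (t : Set E) := by
    simp only [Set.mem_iUnion, not_exists]
    rintro t ⟨ht, hut⟩ hxt
    have hst := K.inter_subset_convexHull hs.1 ht ⟨hs.2, hxt⟩
    rw [← Finset.coe_inter] at hst
    have hne : (s ∩ t).Nonempty := by
      have : (convexHull ℝ ((s ∩ t : Finset E) : Set E)).Nonempty := ⟨_, hst⟩
      rwa [convexHull_nonempty_iff, Finset.coe_nonempty] at this
    have h1 := hmin _ (K.down_closed hs.1 Finset.inter_subset_left hne) hst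
    have h2 := Finset.eq_of_subset_of_card_le Finset.inter_subset_left h1
    exact hut (Finset.mem_inter.1 (h2 ▸ hu)).2
  filter_upwards [(hcl.isOpen_compl.preimage continuous_subtype_val).mem_nhds hxn] with y hy
  obtain ⟨t, ht, hyt⟩ := mem_space_iff.1 y.2
  refine ⟨t, ht, ?_, hyt⟩
  by_contra hut
  exact hy (Set.mem_biUnion (show t ∈ {t ∈ K.faces | u ∉ t} from ⟨ht, hut⟩) hyt)

/-- Being joined to `x` is locally constant, since points of a closed star are joined through its
centre. -/
lemma pathConnectedSpace_space (hK : K.faces.Finite) (hconn : IsConnected K.space) :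
    PathConnectedSpace K.space := by
  have := isConnected_iff_connectedSpace.1 hconn
  refine ⟨inferInstance, fun x y => ?_⟩
  have hloc : IsLocallyConstant fun y : K.space => Joined x y := by
    rw [IsLocallyConstant.iff_eventually_eq]
    intro y
    obtain ⟨u, -, hu⟩ := exists_closedStar_mem_nhds hK y
    have hj : ∀ z : K.space, (z : E) ∈ K.closedStar u → Joined u z := fun z hz =>
      ⟨segmentPath (((starConvex_closedStar _).segment_subset hz).trans (closedStar_subset _))⟩
    have hyu : y ∈ Subtype.val ⁻¹' K.closedStar (u : E) := mem_of_mem_nhds hu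
    filter_upwards [hu] with z hz
    have hyz : Joined y z := (hj y hyu).symm.trans (hj z hz)
    exact propext ⟨fun h => h.trans hyz.symm, fun h => h.trans hyz⟩
  exact (hloc.apply_eq_of_isPreconnected isPreconnected_univ (Set.mem_univ x)
    (Set.mem_univ y)).mp (Joined.refl x)

variable (K) in
/-- The 1-skeleton of a simplicial complex, as a simple graph. -/
def edgeGraph : SimpleGraph K.vertices where
  Adj u v := u ≠ v ∧ ∃ s ∈ K.faces, (u : E) ∈ s ∧ (v : E) ∈ s
  symm := ⟨fun _ _ h => ⟨h.1.symm, h.2.imp fun _ hs => ⟨hs.1, hs.2.2, hs.2.1⟩⟩⟩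
  loopless := ⟨fun _ h => h.1 rfl⟩

/-- A vertex, as a point of the underlying space. -/
def vertexPoint (u : K.vertices) : K.space := ⟨u, vertices_subset_space u.2⟩

lemma vertexPoint_injective : Function.Injective (vertexPoint (K := K)) := fun _ _ h =>
  Subtype.ext (congrArg (fun x : K.space => (x : E)) h)

lemma edgeGraph_adj_segment_subset {u v : K.vertices} (h : K.edgeGraph.Adj u v) :
    segment ℝ (vertexPoint u : E) (vertexPoint v) ⊆ K.space := by
  obtain ⟨-, s, hs, hu, hv⟩ := h
  exact (segment_subset_convexHull hu hv).trans (K.convexHull_subset_space hs)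

/-- A cocycle on the underlying space of a finite complex vanishes on loops if it
is a coboundary on the edges. -/
lemma loop_eq_zero_of_potential (hK : K.faces.Finite) {A : Type*} [AddCommGroup A]
    (Φ : PathCocycle K.space A) (f : K.vertices → A)
    (hf : ∀ u v, K.edgeGraph.Adj u v → Φ.onSegment (vertexPoint u) (vertexPoint v) = f v - f u)
    {x : K.space} (p : Path x x) : Φ p = 0 := by
  have hdiag : ∀ x : K.space, Φ.onSegment x x = 0 := fun x => by
    have := Φ.onSegment_symm (x := x) (y := x) (by simp)
    have h2 := Φ.onSegment_add (x := x) (y := x) (z := x) (S := {(x : E)}) (by simp)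
      (convex_singleton _) rfl rfl rfl
    simpa using h2
  have hf' : ∀ u v : K.vertices, (∃ s ∈ K.faces, (u : E) ∈ s ∧ (v : E) ∈ s) →
      Φ.onSegment (vertexPoint u) (vertexPoint v) = f v - f u := by
    intro u v h
    by_cases e : u = v
    · subst e; simp [hdiag]
    · exact hf u v ⟨e, h⟩
  choose u hu hux using fun x => exists_closedStar_mem_nhds hK x
  let w : K.space → K.vertices := fun x => ⟨u x, hu x⟩
  let F : K.space → A := fun x => f (w x) + Φ.onSegment (u x) x
  -- `F` is independent of the star used: two simplices through `x` share a vertex `b`, and both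
  -- values are compared through `b`.
  have hF : ∀ (v : K.vertices) (x : K.space), (x : E) ∈ K.closedStar v →
      F x = f v + Φ.onSegment (vertexPoint v) x := by
    classical
    rintro v x ⟨s, hs, hvs, hxs⟩
    have hxu : x ∈ Subtype.val ⁻¹' K.closedStar (u x : E) := mem_of_mem_nhds (hux x)
    obtain ⟨t, ht, hut, hxt⟩ := hxu
    have hst := K.inter_subset_convexHull hs ht ⟨hxs, hxt⟩
    obtain ⟨b, hbs, hbt⟩ : ((s : Set E) ∩ t).Nonempty := by
      rw [← convexHull_nonempty_iff (𝕜 := ℝ)]; exact ⟨_, hst⟩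
    let b' : K.vertices := ⟨b, mem_vertices_of_mem hs hbs⟩
    have h1 := Φ.onSegment_add (x := vertexPoint v) (y := vertexPoint b') (z := x)
      (K.convexHull_subset_space hs) (convex_convexHull ℝ _)
      (subset_convexHull ℝ _ hvs) (subset_convexHull ℝ _ hbs) hxs
    have h2 := Φ.onSegment_add (x := vertexPoint (w x)) (y := vertexPoint b') (z := x)
      (K.convexHull_subset_space ht) (convex_convexHull ℝ _)
      (subset_convexHull ℝ _ hut) (subset_convexHull ℝ _ hbt) hxt
    rw [hf' _ _ ⟨s, hs, hvs, hbs⟩] at h1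
    rw [hf' _ _ ⟨t, ht, hut, hbt⟩] at h2
    rw [← h1]
    change f (w x) + Φ.onSegment (vertexPoint (w x)) x = _
    rw [← h2]; abel
  have := Φ.eq_sub_of_local F (fun x => ⟨_, hux x, fun y z p hp => by
    rw [Φ.apply_eq_onSegment_sub (closedStar_subset _) (starConvex_closedStar _) p hp]
    have hy : (y : E) ∈ K.closedStar (u x) := by simpa using hp 0
    have hz : (z : E) ∈ K.closedStar (u x) := by simpa using hp 1
    rw [hF (w x) y hy, hF (w x) z hz]
    exact (add_sub_add_left_eq_sub _ _ _).symm⟩) p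
  simpa using this

end Geometry.SimplicialComplex

/-! ### Cycles in the 1-skeleton -/

namespace Geometry.SimplicialComplex

variable {E : Type*} [NormedAddCommGroup E] [NormedSpace ℝ E] {K : SimplicialComplex ℝ E}

/-- The segment spanned by a dart, as a subset of the underlying space. -/
def dartSegment (d : K.edgeGraph.Dart) : Set K.space :=
  {x | (x : E) ∈ segment ℝ (d.fst : E) d.snd}

/-- Two simplices with vertices `a, b` and `c, d` only meet in the span of the common vertices. -/
lemma mem_convexHull_inter_of_mem_segment {a b c d x : E}
    (hab : ∃ s ∈ K.faces, a ∈ s ∧ b ∈ s) (hcd : ∃ s ∈ K.faces, c ∈ s ∧ d ∈ s)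
    (h₁ : x ∈ segment ℝ a b) (h₂ : x ∈ segment ℝ c d) :
    x ∈ convexHull ℝ ({a, b} ∩ {c, d} : Set E) := by
  classical
  have key : ∀ {a b : E}, (∃ s ∈ K.faces, a ∈ s ∧ b ∈ s) → ({a, b} : Finset E) ∈ K.faces := by
    rintro a b ⟨s, hs, ha, hb⟩
    exact K.down_closed hs (by simp [Finset.insert_subset_iff, ha, hb]) (by simp)
  have := K.inter_subset_convexHull (key hab) (key hcd)
    ⟨by simpa [convexHull_pair] using h₁, by simpa [convexHull_pair] using h₂⟩
  simpa using this

/-- The midpoint of a simplex of dimension at most one does not lie in a segment which does not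
contain the simplex. -/
lemma mem_pair_of_midpoint_mem_segment {a b c d : E}
    (hab : ∃ s ∈ K.faces, a ∈ s ∧ b ∈ s) (hcd : ∃ s ∈ K.faces, c ∈ s ∧ d ∈ s)
    (h : midpoint ℝ a b ∈ segment ℝ c d) : a ∈ ({c, d} : Set E) := by
  by_contra ha
  have h1 := mem_convexHull_inter_of_mem_segment hab hcd (midpoint_mem_segment a b) h
  have h2 : ({a, b} ∩ {c, d} : Set E) ⊆ {b} ∩ {c, d} := by
    rintro x ⟨rfl | hx, hx'⟩
    · exact absurd hx' ha
    · exact ⟨hx, hx'⟩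
  have h3 := convexHull_mono (𝕜 := ℝ) (h2.trans Set.inter_subset_left) h1
  rw [convexHull_singleton, Set.mem_singleton_iff, midpoint_eq_right_iff] at h3
  subst h3
  obtain ⟨y, rfl, hy⟩ := (convexHull_nonempty_iff (𝕜 := ℝ)).1 ⟨_, convexHull_mono h2 h1⟩
  exact ha hy

/-- A walk in the 1-skeleton is realised by a path; its image under a cocycle is the sum of the
values on the edges. -/
lemma exists_path_of_walk {A : Type*} [AddCommGroup A] (Φ : PathCocycle K.space A)
    {u v : K.vertices} (p : K.edgeGraph.Walk u v) (hp : ¬ p.Nil) :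
    ∃ γ : Path (vertexPoint u) (vertexPoint v),
      Φ γ = p.dartSum (fun a b => Φ.onSegment (vertexPoint a) (vertexPoint b)) ∧
      (p.IsPath → Function.Injective γ) ∧ Set.range γ = ⋃ d ∈ p.darts, dartSegment d := by
  have hseg : ∀ {u v : K.vertices} (h : K.edgeGraph.Adj u v),
      Set.range (segmentPath (x := vertexPoint u) (y := vertexPoint v)
        (edgeGraph_adj_segment_subset h)) = dartSegment ⟨(u, v), h⟩ := by
    intro u v h
    ext z
    exact ⟨fun ⟨t, e⟩ => e ▸ segmentPath_mem (x := vertexPoint u) (y := vertexPoint v) _ t,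
      fun hz => exists_segmentPath_eq (x := vertexPoint u) (y := vertexPoint v) _ hz⟩
  induction p with
  -- The empty walk is excluded: its constant path is neither injective nor of empty range.
  | nil => simp at hp
  | @cons u w v h p ih =>
    have hinj := segmentPath_injective (x := vertexPoint u) (y := vertexPoint w)
      (edgeGraph_adj_segment_subset h) (vertexPoint_injective.ne h.1)
    by_cases hn : p.Nil
    · cases p with
      | cons h' p => simp at hn
      | nil =>
        refine ⟨segmentPath (edgeGraph_adj_segment_subset h), ?_, fun _ => hinj, ?_⟩
        · simpa using (Φ.onSegment_eq _).symm
        · simpa using hseg h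
    · obtain ⟨γ, hγ, hγi, hγr⟩ := ih hn
      refine ⟨(segmentPath (edgeGraph_adj_segment_subset h)).trans γ, ?_, fun hpath => ?_, ?_⟩
      · rw [Φ.map_trans, hγ, SimpleGraph.Walk.dartSum_cons,
          Φ.onSegment_eq (edgeGraph_adj_segment_subset h)]
      · rw [SimpleGraph.Walk.cons_isPath_iff] at hpath
        refine Path.trans_injective hinj (hγi hpath.1) ?_
        rw [hseg h, hγr]
        rintro x ⟨hx, hx'⟩
        obtain ⟨d, hd, hxd⟩ := Set.mem_iUnion₂.1 hx'
        have h1 := mem_convexHull_inter_of_mem_segment h.2 d.adj.2 hx hxd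
        have h2 : ({(u : E), (w : E)} ∩ {(d.fst : E), (d.snd : E)} : Set E) ⊆ {(w : E)} := by
          rintro y ⟨rfl | hy, hy'⟩
          · exfalso
            rcases hy' with e | e
            · exact hpath.2 (Subtype.ext e ▸ p.dart_fst_mem_support_of_mem_darts hd)
            · exact hpath.2 (Subtype.ext e ▸ p.dart_snd_mem_support_of_mem_darts hd)
          · exact hy
        have h3 := convexHull_mono (𝕜 := ℝ) h2 h1
        rw [convexHull_singleton] at h3
        exact Subtype.ext h3
      · rw [Path.trans_range, hseg h, hγr]
        simp

/-- If a cycle runs through all simplices, the complex is homeomorphic to the circle. -/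
lemma nonempty_homeomorph_circle_of_isCycle {u : K.vertices} (c : K.edgeGraph.Walk u u)
    (hc : c.IsCycle) (hcov : ∀ x : K.space, ∃ d ∈ c.darts, x ∈ dartSegment d) :
    Nonempty (K.space ≃ₜ Circle) := by
  cases c with
  | nil => exact absurd hc SimpleGraph.Walk.not_isCycle_nil
  | @cons _ w _ h p =>
    rw [SimpleGraph.Walk.cons_isCycle_iff] at hc
    -- Only injectivity and ranges of the paths matter here, so the zero cocycle serves.
    let Φ : PathCocycle K.space ℤ := ⟨fun _ => 0, by simp, by simp⟩
    obtain ⟨α, -, hαi, hαr⟩ := exists_path_of_walk Φ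
      (.cons h (.nil : K.edgeGraph.Walk w w)) (by simp)
    obtain ⟨β, -, hβi, hβr⟩ := exists_path_of_walk Φ p (fun hn => h.1 hn.eq.symm)
    refine nonempty_homeomorph_circle_of_arcs
      (hαi (by simpa using h.1)) (hβi hc.1) ?_ ?_
    · rw [hαr, hβr]
      rintro x ⟨hx, hx'⟩
      replace hx : (x : E) ∈ segment ℝ (u : E) w := by simpa [dartSegment] using hx
      obtain ⟨d, hd, hxd⟩ := Set.mem_iUnion₂.1 hx'
      have h1 := mem_convexHull_inter_of_mem_segment h.2 d.adj.2 hx hxd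
      -- A later dart containing both `u` and `w` would repeat the first edge of the cycle.
      have h2 : ({(u : E), (w : E)} ∩ {(d.fst : E), (d.snd : E)} : Set E) ⊆ {(u : E)} ∨
          ({(u : E), (w : E)} ∩ {(d.fst : E), (d.snd : E)} : Set E) ⊆ {(w : E)} := by
        by_contra! hcon
        simp only [Set.not_subset] at hcon
        obtain ⟨⟨y, ⟨hy, hyd⟩, hyu⟩, ⟨z, ⟨hz, hzd⟩, hzw⟩⟩ := hcon
        have hyw : y = w := by simpa using hy.resolve_left hyu
        have hzu : z = u := hz.resolve_right hzw
        subst hyw hzu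
        apply hc.2
        have : s(u, w) = d.edge := by
          have hne : u ≠ w := h.1
          simp only [Set.mem_insert_iff, Set.mem_singleton_iff, ← Subtype.ext_iff] at hyd hzd
          change _ = s(d.fst, d.snd)
          rw [Sym2.eq_iff]
          grind
        rw [this]
        exact List.mem_map_of_mem hd
      rcases h2 with h2 | h2
      · have h3 := convexHull_mono (𝕜 := ℝ) h2 h1
        rw [convexHull_singleton] at h3
        exact .inl (Subtype.ext h3)
      · have h3 := convexHull_mono (𝕜 := ℝ) h2 h1
        rw [convexHull_singleton] at h3
        exact .inr (Subtype.ext h3)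
    · rw [hαr, hβr, Set.eq_univ_iff_forall]
      intro x
      obtain ⟨d, hd, hxd⟩ := hcov x
      rw [SimpleGraph.Walk.darts_cons, List.mem_cons] at hd
      rcases hd with rfl | hd
      · left; simpa using hxd
      · right; exact Set.mem_biUnion hd hxd

/-- A cycle in a graph which is not a circle misses a point. -/
lemma exists_notMem_dartSegment_of_isCycle (hcard : ∀ s ∈ K.faces, s.card ≤ 2)
    (hcircle : ¬ Nonempty (K.space ≃ₜ Circle)) {u : K.vertices} (c : K.edgeGraph.Walk u u)
    (hc : c.IsCycle) : ∃ x : K.space, ∀ d ∈ c.darts, x ∉ dartSegment d := by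
  by_contra! hcon
  refine hcircle (nonempty_homeomorph_circle_of_isCycle c hc fun x => ?_)
  obtain ⟨s, hs, hx⟩ := mem_space_iff.1 x.2
  -- Allowing `a = b` treats vertices and edges together. A dart whose segment contains the midpoint
  -- must have `a` and `b` among its ends, so it covers the whole simplex.
  obtain ⟨a, b, hsab⟩ : ∃ a b : E, (s : Set E) = {a, b} := by
    classical
    have h0 := (K.nonempty_of_mem_faces hs).card_pos
    rcases (by have := hcard s hs; omega : s.card = 1 ∨ s.card = 2) with h | h
    · obtain ⟨a, rfl⟩ := Finset.card_eq_one.1 h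
      exact ⟨a, a, by simp⟩
    · obtain ⟨a, b, -, rfl⟩ := Finset.card_eq_two.1 h
      exact ⟨a, b, by simp⟩
  have ha : a ∈ (s : Set E) := by rw [hsab]; simp
  have hb : b ∈ (s : Set E) := by rw [hsab]; simp
  have hmid : midpoint ℝ a b ∈ K.space := K.convexHull_subset_space hs
    (segment_subset_convexHull ha hb (midpoint_mem_segment a b))
  obtain ⟨d, hd, hmd⟩ := hcon ⟨_, hmid⟩
  have hmd' : midpoint ℝ a b ∈ segment ℝ (d.fst : E) d.snd := hmd
  have h1 := mem_pair_of_midpoint_mem_segment ⟨s, hs, ha, hb⟩ d.adj.2 hmd'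
  have h2 := mem_pair_of_midpoint_mem_segment ⟨s, hs, hb, ha⟩ d.adj.2
    (midpoint_comm (R := ℝ) a b ▸ hmd')
  refine ⟨d, hd, ?_⟩
  have : (s : Set E) ⊆ {(d.fst : E), (d.snd : E)} := by
    rw [hsab]; rintro y (rfl | rfl) <;> assumption
  have := convexHull_mono (𝕜 := ℝ) this hx
  rwa [convexHull_pair] at this

/-- On a graph which is not a circle, a cocycle that vanishes on loops missing a point vanishes on
all loops. -/
theorem loop_eq_zero_of_missing_point (hfin : K.faces.Finite) (hcard : ∀ s ∈ K.faces, s.card ≤ 2)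
    (hcircle : ¬ Nonempty (K.space ≃ₜ Circle)) {A : Type*} [AddCommGroup A]
    (Φ : PathCocycle K.space A)
    (hΦ : ∀ (z x : K.space) (p : Path x x), (∀ t, p t ≠ z) → Φ p = 0)
    (x : K.space) (p : Path x x) : Φ p = 0 := by
  obtain ⟨f, hf⟩ := SimpleGraph.exists_potential (G := K.edgeGraph)
    (ψ := fun a b => Φ.onSegment (vertexPoint a) (vertexPoint b))
    (fun u v h => Φ.onSegment_symm (edgeGraph_adj_segment_subset h)) (fun u c hc => by
      obtain ⟨z, hz⟩ := exists_notMem_dartSegment_of_isCycle hcard hcircle c hc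
      obtain ⟨γ, hγ, -, hγr⟩ := exists_path_of_walk Φ c hc.not_nil
      rw [← hγ]
      refine hΦ z _ γ fun t e => ?_
      have : z ∈ Set.range γ := ⟨t, e⟩
      rw [hγr] at this
      obtain ⟨d, hd, hzd⟩ := Set.mem_iUnion₂.1 this
      exact hz d hd hzd)
  exact loop_eq_zero_of_potential hfin Φ f hf p

end Geometry.SimplicialComplex

/-! ### Singular 1-cocycles as functions of paths -/

open scoped Simplicial

noncomputable section

namespace TopCat

variable {X : TopCat.{u}}

/-- The singular 1-simplex given by a path. -/
def pathSimplex {x y : X} (p : _root_.Path x y) : toSSet.obj X _⦋1⦌ :=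
  (toSSetObjEquiv X (.op ⦋1⦌)).symm (p.toContinuousMap.comp
    (toContinuousMap stdSimplexHomeomorphUnitInterval))

lemma toSSetObjEquiv_pathSimplex_apply {x y : X} (p : _root_.Path x y)
    (s : _root_.stdSimplex ℝ (Fin 2)) :
    toSSetObjEquiv X (.op ⦋1⦌) (pathSimplex p) s = p (stdSimplexHomeomorphUnitInterval s) := by
  simp [pathSimplex]

lemma δ_zero_pathSimplex {x y : X} (p : _root_.Path x y) :
    (toSSet.obj X).δ 0 (pathSimplex p) = toSSetObj₀Equiv.symm y := by
  have := δ_zero_toSSetObj₁Equiv.symm (X := X)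
    (ofHom (p.toContinuousMap.comp ⟨ULift.down, continuous_uliftDown⟩))
  refine Eq.trans ?_ (this.trans ?_)
  · rfl
  · congr 1
    exact p.target

lemma δ_one_pathSimplex {x y : X} (p : _root_.Path x y) :
    (toSSet.obj X).δ 1 (pathSimplex p) = toSSetObj₀Equiv.symm x := by
  have := δ_one_toSSetObj₁Equiv.symm (X := X)
    (ofHom (p.toContinuousMap.comp ⟨ULift.down, continuous_uliftDown⟩))
  refine Eq.trans ?_ (this.trans ?_)
  · rfl
  · congr 1
    exact p.source

lemma exists_eq_pathSimplex (s : toSSet.obj X _⦋1⦌) :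
    ∃ (x y : X) (p : _root_.Path x y), s = pathSimplex p := by
  refine ⟨_, _, ⟨(toSSetObjEquiv X (.op ⦋1⦌) s).comp
    (toContinuousMap stdSimplexHomeomorphUnitInterval.symm), rfl, rfl⟩, ?_⟩
  apply (toSSetObjEquiv X (.op ⦋1⦌)).injective
  ext t
  rw [toSSetObjEquiv_pathSimplex_apply]
  simp

lemma map_pathSimplex {Y : TopCat.{u}} (f : X ⟶ Y) {x y : X} (p : _root_.Path x y) :
    (toSSet.map f).app _ (pathSimplex p) = pathSimplex (p.map f.hom.continuous) := rfl

/-- The singular 2-simplex given by a continuous map. -/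
def triangle (g : C(_root_.stdSimplex ℝ (Fin 3), X)) : toSSet.obj X _⦋2⦌ :=
  (toSSetObjEquiv X (.op ⦋2⦌)).symm g

lemma δ_triangle (g : C(_root_.stdSimplex ℝ (Fin 3), X)) (i : Fin 3) {x y : X}
    (p : _root_.Path x y)
    (h : ∀ s, g (stdSimplex.map i.succAbove s) = p (stdSimplexHomeomorphUnitInterval s)) :
    (toSSet.obj X).δ i (triangle g) = pathSimplex p := by
  apply (toSSetObjEquiv X (.op ⦋1⦌)).injective
  ext s
  rw [toSSetObjEquiv_pathSimplex_apply, ← h]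
  simp [triangle]

end TopCat

lemma stdSimplex.map_succAbove_apply (i : Fin 3) (s : stdSimplex ℝ (Fin 2)) (j : Fin 3) :
    stdSimplex.map i.succAbove s j = (if i.succAbove 0 = j then s 0 else 0) +
      (if i.succAbove 1 = j then s 1 else 0) := by
  simp [FunOnFinite.linearMap_apply_apply, Finset.sum_filter, Fin.sum_univ_two]

lemma AddCommGrpCat.integerCoeff_hom_ext {A : AddCommGrpCat.{u}} {f g : integerCoeff.{u} ⟶ A}
    (h : f ⟨1⟩ = g ⟨1⟩) : f = g := by
  ext ⟨n⟩
  have key : ∀ f : integerCoeff.{u} ⟶ A, f ⟨n⟩ = n • f ⟨1⟩ := fun f => by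
    rw [← map_zsmul]
    congr 1
    ext
    simp
  rw [key f, key g, h]

/-- The morphism `ℤ ⟶ A` sending `1` to `a`. -/
def AddCommGrpCat.integerCoeffDesc {A : AddCommGrpCat.{u}} (a : A) : integerCoeff.{u} ⟶ A :=
  AddCommGrpCat.ofHom ((zmultiplesHom A a).comp AddEquiv.ulift.toAddMonoidHom)

@[simp] lemma AddCommGrpCat.integerCoeffDesc_one {A : AddCommGrpCat.{u}} (a : A) :
    AddCommGrpCat.integerCoeffDesc a ⟨1⟩ = a := by
  exact one_zsmul a

namespace TopCat

variable {X : TopCat.{u}} {A : AddCommGrpCat.{u}} (φ : (singularChains.obj X).X 1 ⟶ A)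

/-- A basis element of the group of singular chains. -/
abbrev ιSingular {n : ℕ} (s : toSSet.obj X _⦋n⦌) :
    integerCoeff.{u} ⟶ (singularChains.obj X).X n :=
  (toSSet.obj X).ιChainComplex s

lemma ιSingular_d_zero (s : toSSet.obj X _⦋1⦌) :
    ιSingular s ≫ (singularChains.obj X).d 1 0 =
      ιSingular ((toSSet.obj X).δ 0 s) - ιSingular ((toSSet.obj X).δ 1 s) := by
  refine ((toSSet.obj X).ιChainComplex_d (R := integerCoeff.{u}) (n := 0) s).trans ?_
  simp [Fin.sum_univ_succ, sub_eq_add_neg]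
  rfl

lemma ιSingular_d_one (s : toSSet.obj X _⦋2⦌) :
    ιSingular s ≫ (singularChains.obj X).d 2 1 =
      ιSingular ((toSSet.obj X).δ 0 s) - ιSingular ((toSSet.obj X).δ 1 s) +
        ιSingular ((toSSet.obj X).δ 2 s) := by
  refine ((toSSet.obj X).ιChainComplex_d (R := integerCoeff.{u}) (n := 1) s).trans ?_
  simp [Fin.sum_univ_succ, sub_eq_add_neg, add_assoc]
  rfl

lemma ιSingular_map {Y : TopCat.{u}} (f : X ⟶ Y) {n : ℕ} (s : toSSet.obj X _⦋n⦌) :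
    ιSingular s ≫ (singularChains.map f).f n = ιSingular ((toSSet.map f).app _ s) :=
  SSet.ι_chainComplexMap_f _ _ (toSSet.map f) integerCoeff.{u} s

/-- The value of a 1-cochain on a path. -/
def evalPath {x y : X} (p : _root_.Path x y) : A := (ιSingular (pathSimplex p) ≫ φ) ⟨1⟩

variable {φ} (hφ : (singularChains.obj X).d 2 1 ≫ φ = 0)
include hφ

lemma evalPath_triangle (g : C(_root_.stdSimplex ℝ (Fin 3), X)) {x y z : X} (p : _root_.Path x y)
    (q : _root_.Path y z) (r : _root_.Path x z)
    (hp : ∀ s, g (stdSimplex.map (Fin.succAbove 2) s) = p (stdSimplexHomeomorphUnitInterval s))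
    (hq : ∀ s, g (stdSimplex.map (Fin.succAbove 0) s) = q (stdSimplexHomeomorphUnitInterval s))
    (hr : ∀ s, g (stdSimplex.map (Fin.succAbove 1) s) = r (stdSimplexHomeomorphUnitInterval s)) :
    evalPath φ p + evalPath φ q = evalPath φ r := by
  have h : (ιSingular (triangle g) ≫ (singularChains.obj X).d 2 1) ≫ φ = 0 := by
    rw [Category.assoc, hφ, Limits.comp_zero]
  rw [ιSingular_d_one, δ_triangle g 0 q hq, δ_triangle g 1 r hr, δ_triangle g 2 p hp,
    Preadditive.add_comp, Preadditive.sub_comp] at h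
  have h' := congrArg (fun k => k ⟨1⟩) h
  change evalPath φ q - evalPath φ r + evalPath φ p = 0 at h'
  rw [← sub_eq_zero, ← h']; abel

omit hφ in
lemma continuous_stdSimplex_apply {n : ℕ} (i : Fin n) :
    Continuous fun s : _root_.stdSimplex ℝ (Fin n) => s i :=
  (continuous_apply i).comp continuous_subtype_val

lemma evalPath_trans {x y z : X} (p : _root_.Path x y) (q : _root_.Path y z) :
    evalPath φ (p.trans q) = evalPath φ p + evalPath φ q := by
  -- The affine parameter sends the three vertices to 0, 1/2 and 1, so the edges run through `p`,
  -- `q` and their concatenation.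
  let g : C(_root_.stdSimplex ℝ (Fin 3), X) :=
    ⟨fun s => (p.trans q).extend (s 1 / 2 + s 2), (p.trans q).continuous_extend.comp <| by
      exact ((continuous_stdSimplex_apply 1).div_const 2).add (continuous_stdSimplex_apply 2)⟩
  refine (evalPath_triangle hφ g p q (p.trans q) ?_ ?_ ?_).symm <;> intro s <;>
    change (p.trans q).extend _ = _ <;> simp only [stdSimplex.map_succAbove_apply]
  all_goals
    have hs : (stdSimplexHomeomorphUnitInterval s : ℝ) = s 1 := rfl
    have h0 : s 0 = 1 - s 1 := eq_sub_of_add_eq (stdSimplex.add_eq_one s)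
    have h1 : s 1 ≤ 1 := stdSimplex.le_one s 1
    have h2 : 0 ≤ s 1 := stdSimplex.zero_le s 1
  · rw [Path.extend_trans_of_le_half, ← Path.extend_extends' p, hs]
    · congr 1; simp [Fin.succAbove]; ring
    · simp [Fin.succAbove]; linarith
  · rw [Path.extend_trans_of_half_le, ← Path.extend_extends' q, hs]
    · congr 1; simp [Fin.succAbove]; linarith
    · simp [Fin.succAbove]; linarith
  · rw [← Path.extend_extends' (p.trans q), hs]
    congr 1; simp [Fin.succAbove]

lemma evalPath_refl (x : X) : evalPath φ (_root_.Path.refl x) = 0 := by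
  have := evalPath_trans hφ (_root_.Path.refl x) (_root_.Path.refl x)
  rw [Path.refl_trans_refl] at this
  simpa using this

/-- Cut the square of the homotopy along its diagonal `r`: the other sides of the two triangles are
`p`, `q` and constant paths. -/
lemma evalPath_homotopic {x y : X} {p q : _root_.Path x y} (h : p.Homotopic q) :
    evalPath φ p = evalPath φ q := by
  obtain ⟨H⟩ := h
  let P : ℝ → I := Set.projIcc 0 1 zero_le_one
  have hP : Continuous P := continuous_projIcc
  have hP0 : P 0 = 0 := Set.projIcc_left _
  have hP1 : P 1 = 1 := Set.projIcc_right _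
  have hPs : ∀ s : _root_.stdSimplex ℝ (Fin 2), P (s 1) = stdSimplexHomeomorphUnitInterval s :=
    fun s => Set.projIcc_val zero_le_one (stdSimplexHomeomorphUnitInterval s)
  have hc1 := continuous_stdSimplex_apply (1 : Fin 3)
  have hc2 := continuous_stdSimplex_apply (2 : Fin 3)
  let g₁ : C(_root_.stdSimplex ℝ (Fin 3), X) := ⟨fun s => H (P (s 2), P (s 1 + s 2)),
    H.continuous.comp ((hP.comp hc2).prodMk (hP.comp (hc1.add hc2)))⟩
  let g₂ : C(_root_.stdSimplex ℝ (Fin 3), X) := ⟨fun s => H (P (s 1 + s 2), P (s 2)),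
    H.continuous.comp ((hP.comp (hc1.add hc2)).prodMk (hP.comp hc2))⟩
  let r : _root_.Path x y := ⟨⟨fun t => H (t, t), by fun_prop⟩, by simp, by simp⟩
  have e₁ := evalPath_triangle hφ g₁ p (Path.refl y) r
    (fun s => ?_) (fun s => ?_) (fun s => ?_)
  have e₂ := evalPath_triangle hφ g₂ (Path.refl x) q r
    (fun s => ?_) (fun s => ?_) (fun s => ?_)
  · rw [evalPath_refl hφ, add_zero] at e₁
    rw [evalPath_refl hφ, zero_add] at e₂
    rw [e₁, e₂]
  all_goals
    have h0 : s 0 + s 1 = 1 := stdSimplex.add_eq_one s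
    simp only [g₁, g₂, r, ContinuousMap.coe_mk, stdSimplex.map_succAbove_apply]
    simp [Fin.succAbove, h0, hP0, hP1, hPs]

/-- A 1-cocycle, as a function of paths. -/
def pathCocycle : PathCocycle X A where
  toFun p := evalPath φ p
  map_trans p q := evalPath_trans hφ p q
  map_homotopic h := evalPath_homotopic hφ h

/-- A singular 1-cocycle on a path connected space whose values on all loops vanish is a
coboundary. -/
lemma exists_eq_d_comp [PathConnectedSpace X]
    (hloop : ∀ (x : X) (p : _root_.Path x x), evalPath φ p = 0) :
    ∃ ψ : (singularChains.obj X).X 0 ⟶ A, φ = (singularChains.obj X).d 1 0 ≫ ψ := by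
  obtain ⟨f, hf⟩ := (pathCocycle hφ).exists_potential hloop
  let ψ : (singularChains.obj X).X 0 ⟶ A :=
    Limits.Cofan.IsColimit.desc ((toSSet.obj X).isColimitChainComplexXCofan integerCoeff.{u} 0)
      (fun s => AddCommGrpCat.integerCoeffDesc (f (toSSetObj₀Equiv s)))
  have hψ : ∀ s, ιSingular s ≫ ψ = AddCommGrpCat.integerCoeffDesc (f (toSSetObj₀Equiv s)) :=
    fun s => Limits.Cofan.IsColimit.fac _ _ s
  refine ⟨ψ, SSet.chainComplex_hom_ext fun s => ?_⟩
  obtain ⟨x, y, p, rfl⟩ := exists_eq_pathSimplex s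
  change ιSingular _ ≫ φ = ιSingular _ ≫ (singularChains.obj X).d 1 0 ≫ ψ
  rw [← Category.assoc, ιSingular_d_zero, Preadditive.sub_comp, hψ, hψ, δ_zero_pathSimplex,
    δ_one_pathSimplex, Equiv.apply_symm_apply, Equiv.apply_symm_apply]
  refine AddCommGrpCat.integerCoeff_hom_ext ((hf x y p).trans ?_)
  exact congrArg₂ (· - ·) (AddCommGrpCat.integerCoeffDesc_one _).symm
    (AddCommGrpCat.integerCoeffDesc_one _).symm

omit hφ in
/-- A 1-cochain that vanishes on the image of the 1-cycles of `F` vanishes on loops from `F`. -/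
lemma evalPath_map_loop {F : TopCat.{u}} (f : F ⟶ X)
    (h : (singularChains.obj F).iCycles 1 ≫ (singularChains.map f).f 1 ≫ φ = 0)
    {x : F} (p : _root_.Path x x) : evalPath φ (p.map f.hom.continuous) = 0 := by
  -- The simplex of a loop is a cycle, so it factors through the cycles of `F`, where `h` applies.
  have hd : ιSingular (pathSimplex p) ≫ (singularChains.obj F).d 1 0 = 0 := by
    rw [ιSingular_d_zero, δ_zero_pathSimplex, δ_one_pathSimplex, sub_self]
  have hl := (singularChains.obj F).liftCycles_i (ιSingular (pathSimplex p)) 0 (by simp) hd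
  have : ιSingular (pathSimplex (p.map f.hom.continuous)) ≫ φ = 0 := by
    rw [← map_pathSimplex f p, ← ιSingular_map, ← hl, Category.assoc, Category.assoc, h,
      Limits.comp_zero]
  rw [evalPath, this]; rfl

end TopCat
end

/-! ### From loops to homology and cohomology -/

/-- `f : F ⟶ X` detects loops if every homotopy invariant additive function of paths in `X` that
vanishes on loops coming from `F` vanishes on all loops. -/
def DetectsLoops {F X : TopCat.{u}} (f : F ⟶ X) : Prop :=
  ∀ (A : AddCommGrpCat.{u}) (Φ : PathCocycle X A),
    (∀ (x : F) (p : Path x x), Φ (p.map f.hom.continuous) = 0) →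
      ∀ (x : X) (p : Path x x), Φ p = 0

namespace DetectsLoops

variable {F X : TopCat.{u}} {f : F ⟶ X} [PathConnectedSpace X]

lemma exists_eq_d_comp (hf : DetectsLoops f) {A : AddCommGrpCat.{u}}
    {φ : (singularChains.obj X).X 1 ⟶ A} (hφ : (singularChains.obj X).d 2 1 ≫ φ = 0)
    (h : (singularChains.obj F).iCycles 1 ≫ (singularChains.map f).f 1 ≫ φ = 0) :
    ∃ ψ : (singularChains.obj X).X 0 ⟶ A, φ = (singularChains.obj X).d 1 0 ≫ ψ :=
  TopCat.exists_eq_d_comp hφ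
    (hf A (TopCat.pathCocycle hφ) fun _ p => TopCat.evalPath_map_loop f h p)

/-- A map that detects loops is surjective on the first homology. -/
theorem surjective_homology (hf : DetectsLoops f) :
    Function.Surjective ((singularHomologyInt.{u} 1).map f) := by
  let C := singularChains.obj X
  let g := HomologicalComplex.homologyMap (singularChains.map f) 1 ≫ C.homologyι 1
  -- The coefficients are chains modulo boundaries, divided by the image of the homology of `F`.
  let π : C.opcycles 1 ⟶ AddCommGrpCat.of (C.opcycles 1 ⧸ g.hom.range) :=
    AddCommGrpCat.ofHom (QuotientAddGroup.mk' g.hom.range)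
  have hgπ : g ≫ π = 0 := by
    ext x
    exact (QuotientAddGroup.eq_zero_iff _).2 ⟨x, rfl⟩
  obtain ⟨ψ, hψ⟩ := hf.exists_eq_d_comp (φ := C.pOpcycles 1 ≫ π) (by simp [C]) (by
    have : (singularChains.obj F).iCycles 1 ≫ (singularChains.map f).f 1 ≫ C.pOpcycles 1 =
        (singularChains.obj F).homologyπ 1 ≫ g := by
      simp [g, C]
    rw [reassoc_of% this, hgπ, Limits.comp_zero])
  -- A coboundary kills cycles, so every homology class of `X` lies in the image.
  have h0 : C.homologyι 1 ≫ π = 0 := by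
    rw [← cancel_epi (C.homologyπ 1), Limits.comp_zero,
      HomologicalComplex.homology_π_ι_assoc, hψ, HomologicalComplex.iCycles_d_assoc,
      Limits.zero_comp]
  intro x
  obtain ⟨y, hy⟩ := (QuotientAddGroup.eq_zero_iff _).1 (congrArg (fun k => k x) h0 :)
  exact ⟨y, (AddCommGrpCat.mono_iff_injective (C.homologyι 1)).1 inferInstance hy⟩

/-- A map that detects loops is injective on the first cohomology. -/
theorem injective_cohomology (hf : DetectsLoops f) :
    Function.Injective ((singularCohomologyInt.{u} 1).map f.op) := by
  let T := HomologicalComplex.opFunctor AddCommGrpCat.{u} (ComplexShape.down ℕ) ⋙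
    (preadditiveYoneda.obj integerCoeff.{u}).mapHomologicalComplex (ComplexShape.down ℕ).symm
  let M := T.obj (.op (singularChains.obj X))
  let N := T.obj (.op (singularChains.obj F))
  let t : M ⟶ N := T.map (singularChains.map f).op
  change Function.Injective (HomologicalComplex.homologyMap t 1)
  rw [injective_iff_map_eq_zero]
  intro x hx
  obtain ⟨z, rfl⟩ := (AddCommGrpCat.epi_iff_surjective (M.homologyπ 1)).1 inferInstance x
  have hz : N.homologyπ 1 (HomologicalComplex.cyclesMap t 1 z) = 0 := by
    rw [← hx, ← ConcreteCategory.comp_apply, ← ConcreteCategory.comp_apply,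
      HomologicalComplex.homologyπ_naturality]
  have hprev : (ComplexShape.down ℕ).symm.prev 1 = 0 :=
    (ComplexShape.down ℕ).symm.prev_eq' rfl
  have hex := ShortComplex.exact_of_g_is_cokernel
    (ShortComplex.mk _ _ (N.toCycles_comp_homologyπ 0 1)) (N.homologyIsCokernel 0 1 hprev)
  obtain ⟨w, hw⟩ := (ShortComplex.ab_exact_iff _).1 hex _ hz
  have hw' : N.d 0 1 w = t.f 1 (M.iCycles 1 z) := by
    rw [← N.toCycles_i 0 1, ← ConcreteCategory.comp_apply, ← HomologicalComplex.cyclesMap_i,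
      ConcreteCategory.comp_apply, ConcreteCategory.comp_apply]
    exact congrArg _ hw
  -- Elements of the dual complexes are read as homomorphisms: the pullback of `φ` is the coboundary
  -- of `χ`, so it kills the cycles of `F`.
  let φ : (singularChains.obj X).X 1 ⟶ integerCoeff.{u} := M.iCycles 1 z
  let χ : (singularChains.obj F).X 0 ⟶ integerCoeff.{u} := w
  have hφ : (singularChains.obj X).d 2 1 ≫ φ = 0 := by
    have : M.d 1 2 (M.iCycles 1 z) = 0 := by
      rw [← ConcreteCategory.comp_apply, M.iCycles_d]; rfl
    exact this
  have hχ : (singularChains.obj F).d 1 0 ≫ χ = (singularChains.map f).f 1 ≫ φ := hw'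
  obtain ⟨ψ, hψ⟩ := hf.exists_eq_d_comp hφ (by
    rw [← hχ, HomologicalComplex.iCycles_d_assoc, Limits.zero_comp])
  let ψ' : M.X 0 := ψ
  have : M.toCycles 0 1 ψ' = z := by
    apply (AddCommGrpCat.mono_iff_injective (M.iCycles 1)).1 inferInstance
    rw [← ConcreteCategory.comp_apply, M.toCycles_i]
    exact hψ.symm
  rw [← this, ← ConcreteCategory.comp_apply, M.toCycles_comp_homologyπ]
  rfl

end DetectsLoops

/-- A loop off the diagonal is a loop in the configuration space, so the product argument applies.
-/
lemma detectsLoops_configInclusion (X : Type u) [TopologicalSpace X] [PathConnectedSpace X]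
    (hX : ∀ (A : AddCommGrpCat.{u}) (Ψ : PathCocycle X A),
      (∀ (z x : X) (p : Path x x), (∀ t, p t ≠ z) → Ψ p = 0) →
        ∀ (x : X) (p : Path x x), Ψ p = 0) :
    DetectsLoops (configInclusion X) := by
  intro A Φ hΦ a p
  refine PathCocycle.loop_eq_zero_of_offDiag (hX A) Φ (fun a p hp => ?_) a p
  have ha : a.1 ≠ a.2 := by simpa using hp 0
  exact hΦ ⟨a, ha⟩ ⟨⟨fun t => ⟨p t, hp t⟩, by fun_prop⟩, by ext1; simp, by ext1; simp⟩

theorem proposition2p3 {E : Type u} [NormedAddCommGroup E] [NormedSpace ℝ E]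
    (K : Geometry.SimplicialComplex ℝ E) (hK : IsFiniteGraph K)
    (hconn : _root_.IsConnected K.space)
    (hcircle : ¬ Nonempty (K.space ≃ₜ Circle)) :
    Function.Surjective ((singularHomologyInt.{u} 1).map (configInclusion K.space)) ∧
    Function.Injective ((singularCohomologyInt.{u} 1).map (configInclusion K.space).op) := by
  have := Geometry.SimplicialComplex.pathConnectedSpace_space hK.finite_faces hconn
  have hdet := detectsLoops_configInclusion K.space fun A Ψ hΨ =>
    Geometry.SimplicialComplex.loop_eq_zero_of_missing_point hK.finite_faces hK.card_le_two
      hcircle Ψ hΨ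
  have : PathConnectedSpace (TopCat.of (K.space × K.space)) :=
    inferInstanceAs (PathConnectedSpace (K.space × K.space))
  exact ⟨hdet.surjective_homology, hdet.injective_cohomology⟩
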